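/- Let $\mathfrak g$ be a real vector space of finite dimension $n$, with dual $\mathfrak g^*$, and let $S^k(\mathfrak g^*)$ be the degree $k$ part of the symmetric algebra $S(\mathfrak g^*)$ (zero for $k<0$). Let $\Gamma$ be a finite simple $d$-valent graph with vertex set $V$. An axial function $\alpha$ on $\Gamma$ assigns to every pair $(p,e)$, with $e$ an edge containing the vertex $p$, a nonzero vector $\alpha_{p,e}\in\mathfrak g^*$, such that: (i) $\alpha_{p,e}=-\alpha_{q,e}$ if $e$ joins $p$ and $q$; (ii) for every vertex $p$, the vectors $\alpha_{p,e}$, $e\ni p$, are pairwise linearly independent; (iii) if $e$ joins $p$ and $q$, then the edges $e_1,\dots,e_d=e$ at $p$ and $e_1',\dots,e_d'=e$ at $q$ can be ordered so that $\alpha_{p,e_i}$ and $\alpha_{q,e_i'}$ have the same restriction to $\mathfrak g_e=\ker\alpha_{p,e}$ for all $i$. Let $H^{2k}(\Gamma,\alpha)$ be the space of all maps $f:V\to S^k(\mathfrak g^*)$ such that, for every edge $e$ joining vertices $p$ and $q$, $f(p)$ and $f(q)$ have the same image under the restriction map $S(\mathfrak g^*)\to S(\mathfrak g_e^*)$. Let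 $\mathcal P$ be the set of all $\xi\in\mathfrak g$ with $\alpha_{p,e}(\xi)\neq0$ for all $(p,e)$. Every $\xi\in\mathcal P$ orients $\Gamma$: an edge $e$ joining $p$ and $q$ points from $p$ to $q$ if $\alpha_{p,e}(\xi)>0$. Let $\beta_r$ be the number of vertices $p$ for which exactly $r$ edges $e$ at $p$ satisfy $\alpha_{p,e}(\eta)<0$, where $\eta$ is any element of $\mathcal P$ (this number does not depend on the choice of $\eta$). Suppose that for some $\xi\in\mathcal P$ the orientation of $\Gamma$ defined by $\xi$ has no oriented cycles. Then $$\dim H^{2k}(\Gamma,\alpha)\le\sum_r\beta_r\dim S^{k-r}(\mathfrak g^*)\qquad\text{for all }k\ge0,$$ and $$\dim H^{2k}(\Gamma,\alpha)=\sum_r\beta_r\dim S^{k-r}(\mathfrak g^*)+O(k^{n-3})\qquad\text{as }k\to\infty.$$ In particular, if $n=2$, there is a $k_0$ such that $\dim H^{2k}(\Gamma,\alpha)=\sum_r\beta_r\dim S^{k-r}(\mathfrak g^*)$ for all $k>k_0$. -/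

import Mathlib

open Module

noncomputable section

namespace GraphCohomology

/-- The homogeneous component `S^k(M)` of the symmetric algebra of a real vector space `M`:
the span of all products of `k` elements of `M`. -/
def symPower (M : Type*) [AddCommGroup M] [Module ℝ M] (k : ℕ) :
    Submodule ℝ (SymmetricAlgebra ℝ M) :=
  LinearMap.range (SymmetricAlgebra.ι ℝ M) ^ k

/-- The restriction map `𝔤* → 𝔤_β*`, the transpose of the inclusion of the annihilator
`𝔤_β = ker β` of a covector `β` into `𝔤`. -/
def restr {g : Type*} [AddCommGroup g] [Module ℝ g] (β : Dual ℝ g) :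
    Dual ℝ g →ₗ[ℝ] Dual ℝ (LinearMap.ker β) :=
  (LinearMap.ker β).subtype.dualMap

/-- The extension of `restr β` to a ring morphism `S(𝔤*) → S(𝔤_β*)`. -/
def symRestr {g : Type*} [AddCommGroup g] [Module ℝ g] (β : Dual ℝ g) :
    SymmetricAlgebra ℝ (Dual ℝ g) →ₐ[ℝ] SymmetricAlgebra ℝ (Dual ℝ (LinearMap.ker β)) :=
  SymmetricAlgebra.lift ((SymmetricAlgebra.ι ℝ (Dual ℝ (LinearMap.ker β))).comp (restr β))

section Graph

variable {V : Type*} {G : SimpleGraph V} {g : Type*} [AddCommGroup g] [Module ℝ g]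

/-- An axial function with values in `𝔤*`. An incident pair `(p, e)`, where `e` joins `p` to `q`,
is encoded as the dart (oriented edge) `a` with `a.fst = p` and `a.snd = q`; then `a.symm`
encodes `(q, e)`. -/
structure IsAxial (α : G.Dart → Dual ℝ g) : Prop where
  ne_zero : ∀ a, α a ≠ 0
  antisymm : ∀ a, α a = -α a.symm
  pairwise_independent : ∀ a b : G.Dart, a.fst = b.fst → a ≠ b →
    LinearIndependent ℝ ![α a, α b]
  compatible : ∀ a : G.Dart,
    ∃ θ : {b : G.Dart // b.fst = a.fst} ≃ {b : G.Dart // b.fst = a.snd},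
      θ ⟨a, rfl⟩ = ⟨a.symm, rfl⟩ ∧ ∀ b, restr (α a) (α b.1) = restr (α a) (α (θ b).1)

/-- The set `𝒫` of all `ξ ∈ 𝔤` at which no value of `α` vanishes. -/
def generic (α : G.Dart → Dual ℝ g) : Set g :=
  {ξ | ∀ a, α a ξ ≠ 0}

/-- The oriented edges of the orientation defined by `ξ`: there is an edge `e` joining `p` to `q`,
with `α_{p,e}(ξ) > 0`. -/
def OrientedEdge (α : G.Dart → Dual ℝ g) (ξ : g) (p q : V) : Prop :=
  ∃ a : G.Dart, a.fst = p ∧ a.snd = q ∧ 0 < α a ξ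

/-- The orientation defined by `ξ` has no oriented cycles: no nonempty path of oriented edges
returns to its initial point. -/
def NoCycles (α : G.Dart → Dual ℝ g) (ξ : g) : Prop :=
  ∀ p, ¬ Relation.TransGen (OrientedEdge α ξ) p p

/-- `σ_p(ξ)`: the number of edges `e` at `p` with `α_{p,e}(ξ) < 0`. -/
def index (α : G.Dart → Dual ℝ g) (ξ : g) (p : V) : ℕ :=
  Nat.card {a : G.Dart // a.fst = p ∧ α a ξ < 0}

/-- The Betti number `β_r`, computed by means of `ξ`: the number of vertices `p`
with `σ_p(ξ) = r`. -/
def betti (α : G.Dart → Dual ℝ g) (ξ : g) (r : ℕ) : ℕ :=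
  Nat.card {p : V // index α ξ p = r}

/-- `H^{2k}(Γ, α)`: the space of all maps `f : V → S^k(𝔤*)` such that, for every edge `e`
joining `p` to `q`, `f p` and `f q` have the same restriction to `𝔤_e = ker α_{p,e}`. -/
def cohomology (α : G.Dart → Dual ℝ g) (k : ℕ) :
    Submodule ℝ (V → SymmetricAlgebra ℝ (Dual ℝ g)) where
  carrier := {f | (∀ p, f p ∈ symPower (Dual ℝ g) k) ∧
    ∀ a : G.Dart, symRestr (α a) (f a.fst) = symRestr (α a) (f a.snd)}
  add_mem' hf hh := ⟨fun p => add_mem (hf.1 p) (hh.1 p), fun a => by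
    simp only [Pi.add_apply, map_add, hf.2 a, hh.2 a]⟩
  zero_mem' := ⟨fun _ => zero_mem _, fun _ => by simp only [Pi.zero_apply, map_zero]⟩
  smul_mem' c f hf := ⟨fun p => Submodule.smul_mem _ c (hf.1 p), fun a => by
    simp only [Pi.smul_apply, map_smul, hf.2 a]⟩

/-- `∑_r β_r dim S^{k-r}(𝔤*)`, where `S^{k-r}(𝔤*) = 0` for `r > k`. -/
def bettiSum (α : G.Dart → Dual ℝ g) (ξ : g) (k : ℕ) : ℕ :=
  ∑ r ∈ Finset.range (k + 1), betti α ξ r * finrank ℝ (symPower (Dual ℝ g) (k - r))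

end Graph

instance symPower_finite (M : Type*) [AddCommGroup M] [Module ℝ M] [FiniteDimensional ℝ M]
    (k : ℕ) : FiniteDimensional ℝ (symPower M k) :=
  Module.Finite.iff_fg.mpr ((Module.Finite.iff_fg.mp inferInstance).pow k)

/-- The spaces `H^{2k}(Γ, α)` of a finite graph are finite dimensional, so that `finrank` is their
true dimension. -/
instance cohomology_finite {V : Type*} [Finite V] {G : SimpleGraph V} {g : Type*} [AddCommGroup g]
    [Module ℝ g] [FiniteDimensional ℝ g] (α : G.Dart → Dual ℝ g) (k : ℕ) :
    FiniteDimensional ℝ (cohomology α k) :=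
  Module.Finite.of_injective
    (LinearMap.pi fun p : V => LinearMap.codRestrict (symPower (Dual ℝ g) k)
      ((LinearMap.proj p).comp (cohomology α k).subtype) fun f => f.2.1 p)
    fun _ _ hfh => Subtype.ext <| funext fun p => congrArg Subtype.val (congrFun hfh p)

end GraphCohomology

end

/-! The upper bound filters cohomology by support. Let `U` be a set of vertices and `p` a vertex of
`U` that no oriented edge from `U` enters; it exists because there are no oriented cycles. If a
class `f` is supported on `U`, then `f` vanishes at the far end of each edge at `p` with `α_{p,e}(ξ)
< 0`, so `f p` restricts to zero on those hyperplanes. These covectors are pairwise independent,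
hence `f p` is divisible by their product and lies in a copy of `S^{k-r}(𝔤*)`, with `r` the index of
`p`. Removing `p` from `U` and iterating gives `IsAxial.finrank_cohomology_le`.

The lower bound needs no acyclicity. Cohomology is the kernel of a map from the sum over the
vertices of `S^k(𝔤*)` to the sum over the edges of `S^k(𝔤_e*)`, so its dimension is at least `|V|
dim S^k(𝔤*) - |E| dim S^k(𝔤_e*)`. Each edge is negative at exactly one of its ends, so `|E|` is the
sum of the indices. Since `dim S^{k-r}(𝔤*)` is at most `dim S^k(𝔤*) - r dim S^k(𝔤_e*)` up to an
error of order `k^{n-3}`, this is the Betti sum up to that order (`IsAxial.exists_bettiSum_le`). For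
`n = 2` the error is exactly zero for `k > 0`.

The two bounds use different generic vectors; `IsAxial.betti_eq` reconciles them by wall crossing.
-/

noncomputable section

namespace GraphCohomology

/-! ### Graded pieces of the symmetric algebra -/

section SymPower

variable {M N : Type*} [AddCommGroup M] [Module ℝ M] [AddCommGroup N] [Module ℝ N]

/-- The morphism of symmetric algebras induced by a linear map. -/
def symMap (φ : M →ₗ[ℝ] N) : SymmetricAlgebra ℝ M →ₐ[ℝ] SymmetricAlgebra ℝ N :=
  SymmetricAlgebra.lift ((SymmetricAlgebra.ι ℝ N).comp φ)

theorem symMap_ι (φ : M →ₗ[ℝ] N) (m : M) :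
    symMap φ (SymmetricAlgebra.ι ℝ M m) = SymmetricAlgebra.ι ℝ N (φ m) := by
  simp [symMap]

theorem map_symMap_symPower (φ : M →ₗ[ℝ] N) (k : ℕ) :
    (symPower M k).map (symMap φ).toLinearMap =
      ((LinearMap.range φ).map (SymmetricAlgebra.ι ℝ N)) ^ k := by
  rw [symPower, Submodule.map_pow, ← LinearMap.range_comp, ← LinearMap.range_comp]
  congr 2
  ext m
  simp [symMap]

theorem symMap_mem_symPower (φ : M →ₗ[ℝ] N) {k : ℕ} {x : SymmetricAlgebra ℝ M}
    (hx : x ∈ symPower M k) : symMap φ x ∈ symPower N k := by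
  have h : symMap φ x ∈ (symPower M k).map (symMap φ).toLinearMap := ⟨x, hx, rfl⟩
  rw [map_symMap_symPower] at h
  exact pow_le_pow_left' (LinearMap.map_le_range) k h

theorem map_symMap_symPower_of_surjective (φ : M →ₗ[ℝ] N) (hφ : Function.Surjective φ) (k : ℕ) :
    (symPower M k).map (symMap φ).toLinearMap = symPower N k := by
  rw [map_symMap_symPower, LinearMap.range_eq_top.mpr hφ, Submodule.map_top, symPower]

theorem ι_mul_mem_symPower (m : M) {k : ℕ} {x : SymmetricAlgebra ℝ M} (hx : x ∈ symPower M k) :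
    SymmetricAlgebra.ι ℝ M m * x ∈ symPower M (k + 1) := by
  rw [symPower, pow_succ']
  exact Submodule.mul_mem_mul ⟨m, rfl⟩ hx

theorem ι_injective : Function.Injective (SymmetricAlgebra.ι ℝ M) := by
  refine (injective_iff_map_eq_zero _).mpr fun m hm => ?_
  refine (Module.forall_dual_apply_eq_zero_iff ℝ m).mp fun φ => ?_
  have h := SymmetricAlgebra.lift_ι_apply φ m
  rw [hm, map_zero] at h
  exact h.symm

theorem mem_symPower_zero {x : SymmetricAlgebra ℝ M} :
    x ∈ symPower M 0 ↔ ∃ c : ℝ, algebraMap ℝ (SymmetricAlgebra ℝ M) c = x := by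
  rw [symPower, pow_zero, Submodule.mem_one]

/-- Modulo `b` every vector equals its image under `φ`, so every polynomial does too; the induction
keeps the cofactor of `b` homogeneous. -/
theorem exists_eq_symMap_add_ι_mul (φ : M →ₗ[ℝ] M) (b : M) (v : M → ℝ)
    (hφ : ∀ m, m = φ m + v m • b) (k : ℕ) :
    ∀ x ∈ symPower M (k + 1), ∃ h ∈ symPower M k,
      x = symMap φ x + SymmetricAlgebra.ι ℝ M b * h := by
  have hι (m : M) : SymmetricAlgebra.ι ℝ M m =
      SymmetricAlgebra.ι ℝ M (φ m) + v m • SymmetricAlgebra.ι ℝ M b := by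
    rw [← map_smul, ← map_add, ← hφ m]
  induction k with
  | zero =>
    intro x hx
    rw [symPower, zero_add, pow_one] at hx
    obtain ⟨m, rfl⟩ := hx
    refine ⟨algebraMap ℝ _ (v m), mem_symPower_zero.mpr ⟨_, rfl⟩, ?_⟩
    rw [symMap_ι, mul_comm, ← Algebra.smul_def, ← hι m]
  | succ k ih =>
    intro x hx
    rw [symPower, pow_succ'] at hx
    induction hx using Submodule.mul_induction_on' with
    | mem_mul_mem a ha y hy =>
      obtain ⟨m, rfl⟩ := ha
      obtain ⟨h, hh, hyh⟩ := ih y hy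
      refine ⟨v m • y + SymmetricAlgebra.ι ℝ M (φ m) * h,
        add_mem (Submodule.smul_mem _ _ hy) (ι_mul_mem_symPower _ hh), ?_⟩
      rw [map_mul, symMap_ι]
      calc SymmetricAlgebra.ι ℝ M m * y
          = SymmetricAlgebra.ι ℝ M (φ m) * y + v m • SymmetricAlgebra.ι ℝ M b * y := by
            rw [← add_mul, ← hι m]
        _ = SymmetricAlgebra.ι ℝ M (φ m) * (symMap φ y + SymmetricAlgebra.ι ℝ M b * h) +
            v m • SymmetricAlgebra.ι ℝ M b * y := by rw [← hyh]
        _ = _ := by simp only [Algebra.smul_def]; ring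
    | add x hx y hy h1 h2 =>
      obtain ⟨h, hh, hxh⟩ := h1
      obtain ⟨h', hh', hyh⟩ := h2
      refine ⟨h + h', add_mem hh hh', ?_⟩
      rw [map_add]
      nth_rewrite 1 [hxh, hyh]
      ring

theorem finrank_map_add_finrank_inf_ker (f : M →ₗ[ℝ] N) (p : Submodule ℝ M)
    [FiniteDimensional ℝ p] :
    finrank ℝ (p.map f) + finrank ℝ (p ⊓ LinearMap.ker f : Submodule ℝ M) = finrank ℝ p := by
  rw [← LinearMap.finrank_range_add_finrank_ker (f.domRestrict p), LinearMap.range_domRestrict,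
    LinearMap.ker_domRestrict, ← Submodule.map_comap_subtype,
    (Submodule.equivSubtypeMap p _).finrank_eq]

theorem finrank_map_mulLeft (a : SymmetricAlgebra ℝ M) (ha : a ≠ 0)
    (p : Submodule ℝ (SymmetricAlgebra ℝ M)) :
    finrank ℝ (p.map (LinearMap.mulLeft ℝ a)) = finrank ℝ p :=
  (Submodule.equivMapOfInjective _ (mul_right_injective₀ ha) p).finrank_eq.symm

theorem finrank_symPower_zero : finrank ℝ (symPower M 0) = 1 := by
  rw [symPower, pow_zero, Submodule.one_eq_span]
  exact finrank_span_singleton one_ne_zero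

theorem symPower_succ_eq_bot_of_subsingleton [Subsingleton M] (k : ℕ) :
    symPower M (k + 1) = ⊥ := by
  have h : LinearMap.range (SymmetricAlgebra.ι ℝ M) = ⊥ := by
    rw [Subsingleton.elim (SymmetricAlgebra.ι ℝ M) 0, LinearMap.range_zero]
  rw [symPower, pow_succ, h, Submodule.mul_bot]

end SymPower

/-! ### Restriction to hyperplanes, dimensions and divisibility -/

section Restriction

variable {g : Type*} [AddCommGroup g] [Module ℝ g]

theorem symRestr_eq_symMap (β : Dual ℝ g) : symRestr β = symMap (restr β) := rfl

theorem restr_eq_iff {β a b : Dual ℝ g} :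
    restr β a = restr β b ↔ ∀ x, β x = 0 → a x = b x := by
  constructor
  · intro h x hx
    exact LinearMap.congr_fun h ⟨x, hx⟩
  · intro h
    ext x
    exact h x.1 x.2

/-- A vector on which `β` takes the value `1` provides a section of `restr β`. -/
theorem exists_section_restr {β : Dual ℝ g} (hβ : β ≠ 0) :
    ∃ (s : Dual ℝ (LinearMap.ker β) →ₗ[ℝ] Dual ℝ g) (v : g),
      (∀ l, restr β (s l) = l) ∧ ∀ l, l = s (restr β l) + l v • β := by
  obtain ⟨v₀, hv₀⟩ : ∃ v, β v ≠ 0 := by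
    by_contra! h
    exact hβ (LinearMap.ext h)
  obtain ⟨v, hv⟩ : ∃ v, β v = 1 := ⟨(β v₀)⁻¹ • v₀, by simp [hv₀]⟩
  let π : g →ₗ[ℝ] LinearMap.ker β :=
    LinearMap.codRestrict _ (LinearMap.id - β.smulRight v) fun x => by simp [hv]
  have hπ (x : g) : (π x : g) = x - β x • v := rfl
  refine ⟨π.dualMap, v, fun l => ?_, fun l => ?_⟩
  · ext x
    have hx : β x = 0 := x.2
    have h : π x = x := Subtype.ext (by simp [hπ, hx])
    simp [restr, h]
  · ext x
    simp [restr, hπ, mul_comm]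

theorem restr_surjective {β : Dual ℝ g} (hβ : β ≠ 0) : Function.Surjective (restr β) := by
  obtain ⟨s, v, hs, -⟩ := exists_section_restr hβ
  exact fun l => ⟨s l, hs l⟩

theorem symRestr_ι (β l : Dual ℝ g) :
    symRestr β (SymmetricAlgebra.ι ℝ _ l) = SymmetricAlgebra.ι ℝ _ (restr β l) :=
  symMap_ι _ _

theorem eq_symMap_symRestr_add {β : Dual ℝ g} (hβ : β ≠ 0) :
    ∃ s : Dual ℝ (LinearMap.ker β) →ₗ[ℝ] Dual ℝ g,
      ∀ k, ∀ x ∈ symPower (Dual ℝ g) (k + 1), ∃ h ∈ symPower (Dual ℝ g) k,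
        x = symMap s (symRestr β x) + SymmetricAlgebra.ι ℝ _ β * h := by
  obtain ⟨s, v, -, hs⟩ := exists_section_restr hβ
  refine ⟨s, fun k x hx => ?_⟩
  obtain ⟨h, hh, hxh⟩ := exists_eq_symMap_add_ι_mul (s ∘ₗ restr β) β (fun l => l v) hs k x hx
  have hcomp : symMap (s ∘ₗ restr β) = (symMap s).comp (symRestr β) := by
    refine SymmetricAlgebra.algHom_ext (LinearMap.ext fun l => ?_)
    simp [symMap_ι, symRestr_ι]
  rw [hcomp] at hxh
  exact ⟨h, hh, hxh⟩

/-- A section of the restriction splits `x` into a part determined by its restriction and a multiple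
of `β`; the first part vanishes here. -/
theorem exists_eq_ι_mul_of_symRestr_eq_zero {β : Dual ℝ g} (hβ : β ≠ 0) {k : ℕ}
    {x : SymmetricAlgebra ℝ (Dual ℝ g)} (hx : x ∈ symPower (Dual ℝ g) (k + 1))
    (h0 : symRestr β x = 0) :
    ∃ h ∈ symPower (Dual ℝ g) k, x = SymmetricAlgebra.ι ℝ _ β * h := by
  obtain ⟨s, hs⟩ := eq_symMap_symRestr_add hβ
  obtain ⟨h, hh, hxh⟩ := hs k x hx
  refine ⟨h, hh, ?_⟩
  rw [hxh, h0, map_zero, zero_add]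

theorem symRestr_ι_self (β : Dual ℝ g) : symRestr β (SymmetricAlgebra.ι ℝ _ β) = 0 := by
  have h : restr β β = 0 := LinearMap.ext fun x => x.2
  rw [symRestr_ι, h, map_zero]

theorem symPower_inf_ker_symRestr {β : Dual ℝ g} (hβ : β ≠ 0) (k : ℕ) :
    symPower (Dual ℝ g) (k + 1) ⊓ LinearMap.ker (symRestr β).toLinearMap =
      (symPower (Dual ℝ g) k).map (LinearMap.mulLeft ℝ (SymmetricAlgebra.ι ℝ _ β)) := by
  ext x
  constructor
  · rintro ⟨hx, h0⟩
    obtain ⟨h, hh, rfl⟩ := exists_eq_ι_mul_of_symRestr_eq_zero hβ hx h0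
    exact ⟨h, hh, rfl⟩
  · rintro ⟨h, hh, rfl⟩
    refine ⟨ι_mul_mem_symPower β hh, ?_⟩
    simp [symRestr_ι_self]

/-- Dimension count in the exact sequence `0 → S^k(𝔤*) → S^{k+1}(𝔤*) → S^{k+1}(𝔤_β*) → 0`, whose
first map is multiplication by `β`. It is Pascal's rule for `Nat.multichoose`. -/
theorem finrank_symPower_succ [FiniteDimensional ℝ g] {β : Dual ℝ g} (hβ : β ≠ 0) (k : ℕ) :
    finrank ℝ (symPower (Dual ℝ g) (k + 1)) =
      finrank ℝ (symPower (Dual ℝ (LinearMap.ker β)) (k + 1)) +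
        finrank ℝ (symPower (Dual ℝ g) k) := by
  rw [← finrank_map_add_finrank_inf_ker (symRestr β).toLinearMap, symPower_inf_ker_symRestr hβ,
    finrank_map_mulLeft _ (fun h => hβ (ι_injective (h.trans (map_zero _).symm))),
    symRestr_eq_symMap, map_symMap_symPower_of_surjective _ (restr_surjective hβ)]

theorem finrank_ker_add_one [FiniteDimensional ℝ g] {β : Dual ℝ g} (hβ : β ≠ 0) :
    finrank ℝ (LinearMap.ker β) + 1 = finrank ℝ g :=
  Module.Dual.finrank_ker_add_one_of_ne_zero hβ

theorem finrank_symPower_dual_of_finrank_eq (n : ℕ) :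
    ∀ {g : Type*} [AddCommGroup g] [Module ℝ g] [FiniteDimensional ℝ g], finrank ℝ g = n →
      ∀ k, finrank ℝ (symPower (Dual ℝ g) k) = n.multichoose k := by
  induction n with
  | zero =>
    intro g _ _ _ hg k
    have : Subsingleton g := finrank_zero_iff.mp hg
    cases k with
    | zero => rw [finrank_symPower_zero, Nat.multichoose_zero_right]
    | succ k => rw [symPower_succ_eq_bot_of_subsingleton, finrank_bot, Nat.multichoose_zero_succ]
  | succ n ih =>
    intro g _ _ _ hg k
    have : Nontrivial g := nontrivial_of_finrank_pos (R := ℝ) (by omega)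
    obtain ⟨β, hβ⟩ := exists_ne (0 : Dual ℝ g)
    induction k with
    | zero => rw [finrank_symPower_zero, Nat.multichoose_zero_right]
    | succ k ihk =>
      have := finrank_ker_add_one hβ
      rw [finrank_symPower_succ hβ, ihk, ih (by omega), Nat.multichoose_succ_succ]

theorem finrank_symPower_dual [FiniteDimensional ℝ g] (k : ℕ) :
    finrank ℝ (symPower (Dual ℝ g) k) = (finrank ℝ g).multichoose k :=
  finrank_symPower_dual_of_finrank_eq _ rfl k

theorem restr_ne_zero_of_linearIndependent {a b : Dual ℝ g} (h : LinearIndependent ℝ ![a, b]) :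
    restr a b ≠ 0 := by
  intro h0
  have ha : a ≠ 0 := h.ne_zero 0
  obtain ⟨s, v, -, hs⟩ := exists_section_restr ha
  have hb := hs b
  rw [h0, map_zero, zero_add] at hb
  rw [LinearIndependent.pair_iff] at h
  have := h (b v) (-1) (by rw [← hb]; simp)
  simp at this

/-- A homogeneous element whose restrictions to pairwise distinct hyperplanes vanish is divisible
by the product of the equations of these hyperplanes. -/
theorem exists_eq_prod_mul {ι : Type*} (s : Finset ι) (β : ι → Dual ℝ g)
    (hβ : ∀ i ∈ s, β i ≠ 0)
    (hind : ∀ i ∈ s, ∀ j ∈ s, i ≠ j → LinearIndependent ℝ ![β i, β j]) {k : ℕ}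
    {x : SymmetricAlgebra ℝ (Dual ℝ g)} (hx : x ∈ symPower (Dual ℝ g) k)
    (h0 : ∀ i ∈ s, symRestr (β i) x = 0) :
    ∃ h, (if s.card ≤ k then h ∈ symPower (Dual ℝ g) (k - s.card) else h = 0) ∧
      x = (∏ i ∈ s, SymmetricAlgebra.ι ℝ _ (β i)) * h := by
  classical
  induction s using Finset.induction_on with
  | empty => exact ⟨x, by simpa using hx, by simp⟩
  | insert i s hi ih =>
    obtain ⟨h, hh, hxh⟩ := ih (fun j hj => hβ j (Finset.mem_insert_of_mem hj))
      (fun j hj l hl => hind j (Finset.mem_insert_of_mem hj) l (Finset.mem_insert_of_mem hl))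
      (fun j hj => h0 j (Finset.mem_insert_of_mem hj))
    rw [Finset.card_insert_of_notMem hi, Finset.prod_insert hi]
    -- The other factors stay nonzero on `ker (β i)` by independence, and the symmetric algebra of
    -- its dual is a domain.
    have hi0 : symRestr (β i) h = 0 := by
      have h1 := h0 i (Finset.mem_insert_self i s)
      rw [hxh, map_mul, map_prod] at h1
      refine (mul_eq_zero.mp h1).resolve_left (Finset.prod_ne_zero_iff.mpr fun j hj hz => ?_)
      rw [symRestr_ι] at hz
      refine restr_ne_zero_of_linearIndependent (hind i (Finset.mem_insert_self i s) j
        (Finset.mem_insert_of_mem hj) ?_) (ι_injective (hz.trans (map_zero _).symm))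
      rintro rfl
      exact hi hj
    rcases lt_trichotomy s.card k with hlt | heq | hgt
    · rw [if_pos hlt.le] at hh
      obtain ⟨m, hm⟩ : ∃ m, k = s.card + (m + 1) := ⟨k - s.card - 1, by omega⟩
      rw [show k - s.card = m + 1 by omega] at hh
      obtain ⟨h', hh', rfl⟩ :=
        exists_eq_ι_mul_of_symRestr_eq_zero (hβ i (Finset.mem_insert_self i s)) hh hi0
      refine ⟨h', ?_, by rw [hxh]; ring⟩
      rw [if_pos (by omega), show k - (s.card + 1) = m by omega]
      exact hh'
    -- The cofactor is now a constant, which restriction preserves; so it is zero.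
    · rw [if_pos heq.le, heq, Nat.sub_self] at hh
      obtain ⟨c, rfl⟩ := mem_symPower_zero.mp hh
      rw [AlgHom.commutes, SymmetricAlgebra.algebraMap_eq_zero_iff] at hi0
      refine ⟨0, by rw [if_neg (by omega)], ?_⟩
      rw [hxh, hi0, map_zero, mul_zero, mul_zero]
    · rw [if_neg (by omega)] at hh
      refine ⟨0, by rw [if_neg (by omega)], ?_⟩
      rw [hxh, hh, mul_zero, mul_zero]

theorem finrank_le_of_symRestr_eq_zero [FiniteDimensional ℝ g] {ι : Type*} (s : Finset ι)
    (β : ι → Dual ℝ g) (hβ : ∀ i ∈ s, β i ≠ 0)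
    (hind : ∀ i ∈ s, ∀ j ∈ s, i ≠ j → LinearIndependent ℝ ![β i, β j]) (k : ℕ)
    (W : Submodule ℝ (SymmetricAlgebra ℝ (Dual ℝ g))) (hW : W ≤ symPower (Dual ℝ g) k)
    (h0 : ∀ x ∈ W, ∀ i ∈ s, symRestr (β i) x = 0) :
    finrank ℝ W ≤ if s.card ≤ k then finrank ℝ (symPower (Dual ℝ g) (k - s.card)) else 0 := by
  have key (x) (hx : x ∈ W) := exists_eq_prod_mul s β hβ hind (hW hx) (h0 x hx)
  split_ifs at key ⊢ with hs
  · have hle : W ≤ (symPower (Dual ℝ g) (k - s.card)).map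
        (LinearMap.mulLeft ℝ (∏ i ∈ s, SymmetricAlgebra.ι ℝ _ (β i))) := by
      intro x hx
      obtain ⟨h, hh, rfl⟩ := key x hx
      exact ⟨h, hh, rfl⟩
    exact (Submodule.finrank_mono hle).trans (Submodule.finrank_map_le _ _)
  · have hbot : W = ⊥ := by
      refine (Submodule.eq_bot_iff _).mpr fun x hx => ?_
      obtain ⟨h, rfl, rfl⟩ := key x hx
      exact mul_zero _
    rw [hbot, finrank_bot]

end Restriction

open Filter Topology

/-! ### Independence of the Betti numbers from the generic vector -/

section Betti

variable {V : Type*} {G : SimpleGraph V} {g : Type*} [AddCommGroup g] [Module ℝ g]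

theorem finite_dart [Finite V] : Finite G.Dart :=
  Finite.of_injective _ SimpleGraph.Dart.toProd_injective

/-- An affine function with value `c` at `t` and slope `e` is negative just before `t`. -/
def negBefore (c e : ℝ) : Prop := c < 0 ∨ c = 0 ∧ 0 < e

/-- An affine function with value `c` at `t` and slope `e` is negative just after `t`. -/
def negAfter (c e : ℝ) : Prop := c < 0 ∨ c = 0 ∧ e < 0

/-- The number of vertices with exactly `r` outgoing darts satisfying `P`. -/
def count (P : G.Dart → Prop) (r : ℕ) : ℕ :=
  Nat.card {p : V // Nat.card {a : G.Dart // a.fst = p ∧ P a} = r}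

theorem count_congr {P Q : G.Dart → Prop} (h : ∀ a, P a ↔ Q a) (r : ℕ) :
    count P r = count Q r := by
  rw [show P = Q from funext fun a => propext (h a)]

theorem count_eq_of_perm {P Q : G.Dart → Prop} (τ : Equiv.Perm V)
    (h : ∀ p, Nat.card {a : G.Dart // a.fst = p ∧ P a} =
      Nat.card {a : G.Dart // a.fst = τ p ∧ Q a}) (r : ℕ) : count P r = count Q r :=
  Nat.card_congr (τ.subtypeEquiv fun p => by rw [h])

theorem IsAxial.eq_of_apply_eq_zero {α : G.Dart → Dual ℝ g} (hα : IsAxial α) {x : g}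
    (hx : ∀ a b, LinearIndependent ℝ ![α a, α b] → ¬ (α a x = 0 ∧ α b x = 0)) {a b : G.Dart}
    (hab : a.fst = b.fst) (ha : α a x = 0) (hb : α b x = 0) : a = b := by
  by_contra hne
  exact hx a b (hα.pairwise_independent a b hab hne) ⟨ha, hb⟩

theorem IsAxial.apply_symm {α : G.Dart → Dual ℝ g} (hα : IsAxial α) (a : G.Dart) (x : g) :
    α a.symm x = -α a x := by
  rw [hα.antisymm a, LinearMap.neg_apply, neg_neg]

open Classical in
/-- The involution of the set of vertices that interchanges the ends of the edges of a
hyperplane through `x`. -/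
def swapAt (α : G.Dart → Dual ℝ g) (x : g) (p : V) : V :=
  if h : ∃ a : G.Dart, a.fst = p ∧ α a x = 0 then h.choose.snd else p

theorem IsAxial.swapAt_eq_snd {α : G.Dart → Dual ℝ g} (hα : IsAxial α) {x : g}
    (hx : ∀ a b, LinearIndependent ℝ ![α a, α b] → ¬ (α a x = 0 ∧ α b x = 0)) {a : G.Dart}
    (ha : α a x = 0) : swapAt α x a.fst = a.snd := by
  have h : ∃ b : G.Dart, b.fst = a.fst ∧ α b x = 0 := ⟨a, rfl, ha⟩
  rw [swapAt, dif_pos h, hα.eq_of_apply_eq_zero hx h.choose_spec.1 h.choose_spec.2 ha]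

theorem swapAt_eq_self {α : G.Dart → Dual ℝ g} {x : g} {p : V}
    (h : ¬ ∃ a : G.Dart, a.fst = p ∧ α a x = 0) : swapAt α x p = p := by
  rw [swapAt, dif_neg h]

theorem IsAxial.swapAt_involutive {α : G.Dart → Dual ℝ g} (hα : IsAxial α) {x : g}
    (hx : ∀ a b, LinearIndependent ℝ ![α a, α b] → ¬ (α a x = 0 ∧ α b x = 0)) :
    Function.Involutive (swapAt α x) := by
  intro p
  by_cases h : ∃ a : G.Dart, a.fst = p ∧ α a x = 0
  · obtain ⟨a, rfl, ha⟩ := h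
    have hs : α a.symm x = 0 := by rw [hα.apply_symm, ha, neg_zero]
    rw [hα.swapAt_eq_snd hx ha]
    exact hα.swapAt_eq_snd hx hs
  · rw [swapAt_eq_self h, swapAt_eq_self h]

/-- Crossing one hyperplane does not change the numbers of vertices of given index. -/
theorem IsAxial.count_negBefore_eq_count_negAfter {α : G.Dart → Dual ℝ g} (hα : IsAxial α)
    {x : g} (y : g)
    (hx : ∀ a b, LinearIndependent ℝ ![α a, α b] → ¬ (α a x = 0 ∧ α b x = 0)) (r : ℕ) :
    count (fun a => negBefore (α a x) (α a y)) r = count (fun a => negAfter (α a x) (α a y)) r := by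
  -- At most one edge at each vertex vanishes at `x`. Interchanging the ends of such edges matches
  -- the indices before and after the crossing.
  refine count_eq_of_perm (hα.swapAt_involutive hx).toPerm (fun p => ?_) r
  rw [Function.Involutive.coe_toPerm]
  by_cases h : ∃ a : G.Dart, a.fst = p ∧ α a x = 0
  · obtain ⟨a, rfl, ha⟩ := h
    rw [hα.swapAt_eq_snd hx ha]
    obtain ⟨θ, hθa, hθ⟩ := hα.compatible a
    have key (b : {b : G.Dart // b.fst = a.fst}) :
        negBefore (α b.1 x) (α b.1 y) ↔ negAfter (α (θ b).1 x) (α (θ b).1 y) := by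
      have hval : α b.1 x = α (θ b).1 x := restr_eq_iff.mp (hθ b) x ha
      by_cases hb : α b.1 x = 0
      -- The edge that is crossed has opposite slopes at its two ends, which exchanges "before" and
      -- "after". All other edges keep their nonzero values under `θ`, because `x` lies in `ker (α
      -- a)`.
      · obtain rfl : b = ⟨a, rfl⟩ := Subtype.ext (hα.eq_of_apply_eq_zero hx b.2 hb ha)
        rw [hθa, hα.apply_symm, hα.apply_symm, ha, negBefore, negAfter]
        simp
      · rw [negBefore, negAfter, ← hval]
        simp [hb]
    refine Nat.card_congr ((Equiv.subtypeSubtypeEquivSubtypeInter (fun b : G.Dart => b.fst = a.fst)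
      (fun b => negBefore (α b x) (α b y))).symm.trans ((θ.subtypeEquiv key).trans
        (Equiv.subtypeSubtypeEquivSubtypeInter (fun b : G.Dart => b.fst = a.snd)
      (fun b => negAfter (α b x) (α b y)))))
  · rw [swapAt_eq_self h]
    refine Nat.card_congr (Equiv.subtypeEquivRight fun b => and_congr_right fun hb => ?_)
    have hb0 : α b x ≠ 0 := fun hb0 => h ⟨b, hb, hb0⟩
    simp [negBefore, negAfter, hb0]

/-- A nonzero value keeps its sign near `t₀`; at a zero the sign on each side is read off from the
slope. -/
theorem eventually_negBefore_iff (c e : ℝ) (t₀ : ℝ) (hce : c + t₀ * e = 0 → e ≠ 0) :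
    ∀ᶠ t in 𝓝 t₀, (t < t₀ → (negBefore (c + t * e) e ↔ negBefore (c + t₀ * e) e)) ∧
      (t₀ < t → (negBefore (c + t * e) e ↔ negAfter (c + t₀ * e) e)) := by
  have hcont : Tendsto (fun t : ℝ => c + t * e) (𝓝 t₀) (𝓝 (c + t₀ * e)) :=
    Continuous.tendsto (by fun_prop) t₀
  rcases lt_trichotomy (c + t₀ * e) 0 with h | h | h
  · filter_upwards [hcont.eventually_lt_const h] with t ht
    simp [negBefore, negAfter, h, ht]
  · refine Eventually.of_forall fun t => ?_
    have hct : c + t * e = (t - t₀) * e := by linear_combination h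
    rw [h, hct]
    have he := hce h
    constructor <;> intro ht
    · have hts : t - t₀ < 0 := sub_neg.mpr ht
      simp [negBefore, mul_neg_iff, hts, hts.not_gt, hts.ne, he]
    · have hts : 0 < t - t₀ := sub_pos.mpr ht
      simp [negBefore, negAfter, mul_neg_iff, hts, hts.not_gt, hts.ne', he]
  · filter_upwards [hcont.eventually_const_lt h] with t ht
    simp [negBefore, negAfter, h.ne', h.not_gt, ht.ne', ht.not_gt]

/-- The Betti numbers agree at the ends of a segment that crosses the hyperplanes of the axial
function one at a time. -/
theorem IsAxial.betti_eq_of_segment [Finite V] {α : G.Dart → Dual ℝ g} (hα : IsAxial α)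
    {ξ η : g} (hξ : ξ ∈ generic α) (hη : η ∈ generic α)
    (hsep : ∀ a b, LinearIndependent ℝ ![α a, α b] → α a ξ * α b η ≠ α b ξ * α a η) (r : ℕ) :
    betti α ξ r = betti α η r := by
  have : Finite G.Dart := finite_dart
  let F : ℝ → ℕ := fun t => count (fun a => negBefore (α a ξ + t * α a (η - ξ)) (α a (η - ξ))) r
  -- If both covectors vanished at parameter `t`, eliminating would give `t` times the minor in
  -- `hsep` equal to zero, while `t = 0` is excluded by genericity of `ξ`.
  have hcross (t : ℝ) (a b : G.Dart) (hab : LinearIndependent ℝ ![α a, α b]) :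
      ¬ (α a (ξ + t • (η - ξ)) = 0 ∧ α b (ξ + t • (η - ξ)) = 0) := by
    rintro ⟨ha, hb⟩
    simp only [map_add, map_smul, map_sub, smul_eq_mul] at ha hb
    have h1 := hsep a b hab
    have ht : t ≠ 0 := by
      rintro rfl
      exact hξ a (by linear_combination ha)
    refine h1 (mul_left_cancel₀ ht ?_)
    linear_combination α a ξ * hb - α b ξ * ha
  have hswap (t : ℝ) : F t =
      count (fun a => negAfter (α a ξ + t * α a (η - ξ)) (α a (η - ξ))) r := by
    have h := hα.count_negBefore_eq_count_negAfter (η - ξ) (hcross t) r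
    simpa only [map_add, map_smul, smul_eq_mul] using h
  -- To the left of `t₀`, `F` agrees with its value at `t₀`; to the right it agrees with the count
  -- "after" `t₀`, which is the same number by `hswap`.
  have hloc : IsLocallyConstant F := by
    refine (IsLocallyConstant.iff_eventually_eq F).mpr fun t₀ => ?_
    have hev : ∀ᶠ t in 𝓝 t₀, ∀ a : G.Dart, (t < t₀ →
        (negBefore (α a ξ + t * α a (η - ξ)) (α a (η - ξ)) ↔
          negBefore (α a ξ + t₀ * α a (η - ξ)) (α a (η - ξ)))) ∧
        (t₀ < t → (negBefore (α a ξ + t * α a (η - ξ)) (α a (η - ξ)) ↔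
          negAfter (α a ξ + t₀ * α a (η - ξ)) (α a (η - ξ)))) :=
      eventually_all.mpr fun a => eventually_negBefore_iff _ _ _ fun h h0 =>
        hξ a (by simpa [h0] using h)
    filter_upwards [hev] with t ht
    rcases lt_trichotomy t t₀ with h | h | h
    · exact count_congr (fun a => (ht a).1 h) r
    · rw [h]
    · rw [hswap t₀]
      exact count_congr (fun a => (ht a).2 h) r
  have h01 := hloc.apply_eq_of_preconnectedSpace 0 1
  have h0 : F 0 = betti α ξ r := count_congr (fun a => by simp [negBefore, hξ a]) r
  have h1 : F 1 = betti α η r := count_congr (fun a => by simp [negBefore, hη a]) r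
  rw [← h0, ← h1, h01]

theorem exists_forall_apply_ne_zero {ι : Type*} [Finite ι] (f : ι → Dual ℝ g)
    (hf : ∀ i, f i ≠ 0) : ∃ v, ∀ i, f i v ≠ 0 := by
  have := Fintype.ofFinite ι
  obtain ⟨v, hv⟩ := Module.Dual.exists_forall_mem_ne_zero_of_forall_exists (p := ⊤) f
    fun i => by
      by_contra! h
      exact hf i (LinearMap.ext fun x => h x trivial)
  exact ⟨v, hv.2⟩

/-- The Betti numbers do not depend on the generic vector used to define them. -/
theorem IsAxial.betti_eq [Finite V] {α : G.Dart → Dual ℝ g} (hα : IsAxial α)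
    {ξ η : g} (hξ : ξ ∈ generic α) (hη : η ∈ generic α) (r : ℕ) :
    betti α ξ r = betti α η r := by
  have : Finite G.Dart := finite_dart
  let I := {c : G.Dart × G.Dart // LinearIndependent ℝ ![α c.1, α c.2]}
  -- The minor of `betti_eq_of_segment` as a functional of the endpoint. Moving `η` slightly along a
  -- `v` outside all the kernels makes every minor nonzero without changing the sign of any `α a` at
  -- `η`.
  let f : I → Dual ℝ g := fun c => α c.1.1 ξ • α c.1.2 - α c.1.2 ξ • α c.1.1
  obtain ⟨v, hv⟩ := exists_forall_apply_ne_zero f fun c hc => by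
    have h := LinearIndependent.pair_iff.mp c.2 (-α c.1.2 ξ) (α c.1.1 ξ) (by
      rw [neg_smul, neg_add_eq_sub]; exact hc)
    exact hξ _ h.2
  have hev1 : ∀ᶠ ε in 𝓝[>] (0 : ℝ), ∀ c, f c (η + ε • v) ≠ 0 := by
    refine eventually_all.mpr fun c => ?_
    have hne : ∀ᶠ ε in 𝓝[>] (0 : ℝ), ε ≠ -(f c η) / f c v := by
      rcases eq_or_ne (-(f c η) / f c v) 0 with h | h
      · rw [h]
        filter_upwards [self_mem_nhdsWithin] with ε hε using ne_of_gt hε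
      · exact nhdsWithin_le_nhds (isOpen_ne.mem_nhds h.symm)
    filter_upwards [hne] with ε hε h0
    rw [map_add, map_smul, smul_eq_mul] at h0
    refine hε ((eq_div_iff (hv c)).mpr ?_)
    linarith
  have hev2 : ∀ᶠ ε in 𝓝[>] (0 : ℝ), ∀ a, 0 < α a (η + ε • v) * α a η := by
    refine eventually_all.mpr fun a => nhdsWithin_le_nhds ?_
    have hcont : Tendsto (fun ε : ℝ => α a (η + ε • v) * α a η) (𝓝 0)
        (𝓝 (α a (η + (0 : ℝ) • v) * α a η)) := by
      simp only [map_add, map_smul, smul_eq_mul]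
      exact Continuous.tendsto (by fun_prop) 0
    refine hcont.eventually_const_lt ?_
    rw [zero_smul, add_zero]
    exact mul_self_pos.mpr (hη a)
  obtain ⟨ε, h1, h2⟩ := (hev1.and hev2).exists
  have hgen : η + ε • v ∈ generic α := fun a h => by
    have := h2 a
    rw [h, zero_mul] at this
    exact lt_irrefl _ this
  rw [hα.betti_eq_of_segment hξ hgen (fun a b hab heq => h1 ⟨(a, b), hab⟩ (by
    simp only [f, LinearMap.sub_apply, LinearMap.smul_apply, smul_eq_mul]
    exact sub_eq_zero.mpr heq)) r]
  refine count_congr (fun a => ?_) r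
  rcases mul_pos_iff.mp (h2 a) with h | h
  · exact iff_of_false h.1.not_gt h.2.not_gt
  · exact iff_of_true h.1 h.2

end Betti

/-! ### Upper bound by filtering by support -/

section UpperBound

variable {V : Type*} {G : SimpleGraph V} {g : Type*} [AddCommGroup g] [Module ℝ g]

/-- The contribution of the vertex `p` to `bettiSum`. -/
def vertexDim (α : G.Dart → Dual ℝ g) (ξ : g) (k : ℕ) (p : V) : ℕ :=
  if index α ξ p ≤ k then finrank ℝ (symPower (Dual ℝ g) (k - index α ξ p)) else 0

theorem sum_vertexDim [Fintype V] (α : G.Dart → Dual ℝ g) (ξ : g) (k : ℕ) :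
    ∑ p, vertexDim α ξ k p = bettiSum α ξ k := by
  classical
  have hw (p : V) : vertexDim α ξ k p = ∑ r ∈ Finset.range (k + 1),
      if index α ξ p = r then finrank ℝ (symPower (Dual ℝ g) (k - r)) else 0 := by
    rw [Finset.sum_ite_eq, vertexDim]
    simp only [Finset.mem_range, Nat.lt_succ_iff]
  simp only [hw]
  rw [Finset.sum_comm, bettiSum]
  refine Finset.sum_congr rfl fun r _ => ?_
  rw [← Finset.sum_filter, Finset.sum_const, smul_eq_mul, betti, Nat.card_eq_fintype_card,
    Fintype.card_subtype]

theorem bettiSum_congr {α : G.Dart → Dual ℝ g} {ξ η : g} (h : ∀ r, betti α ξ r = betti α η r)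
    (k : ℕ) : bettiSum α ξ k = bettiSum α η k := by
  simp only [bettiSum, h]

/-- The cohomology classes supported on `U`. -/
def supportedOn (α : G.Dart → Dual ℝ g) (k : ℕ) (U : Finset V) :
    Submodule ℝ (V → SymmetricAlgebra ℝ (Dual ℝ g)) :=
  cohomology α k ⊓ Submodule.pi (↑U)ᶜ fun _ => ⊥

theorem mem_supportedOn {α : G.Dart → Dual ℝ g} {k : ℕ} {U : Finset V}
    {f : V → SymmetricAlgebra ℝ (Dual ℝ g)} :
    f ∈ supportedOn α k U ↔ f ∈ cohomology α k ∧ ∀ p ∉ U, f p = 0 := by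
  simp [supportedOn, Submodule.mem_pi]

instance supportedOn_finite [Finite V] [FiniteDimensional ℝ g] (α : G.Dart → Dual ℝ g) (k : ℕ)
    (U : Finset V) : FiniteDimensional ℝ (supportedOn α k U) :=
  Submodule.finiteDimensional_of_le (inf_le_left : supportedOn α k U ≤ cohomology α k)

/-- Edges negative at `p` come from outside `U`, where the class vanishes; so its value at `p` is
divisible by the product of their covectors. -/
theorem IsAxial.finrank_map_proj_supportedOn_le [Finite V] [FiniteDimensional ℝ g]
    {α : G.Dart → Dual ℝ g} (hα : IsAxial α) (ξ : g) (k : ℕ) (U : Finset V) (p : V)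
    (hp : ∀ q ∈ U, ¬ OrientedEdge α ξ q p) :
    finrank ℝ ((supportedOn α k U).map (LinearMap.proj p)) ≤ vertexDim α ξ k p := by
  classical
  have : Finite G.Dart := finite_dart
  have := Fintype.ofFinite G.Dart
  let s : Finset G.Dart := {a | a.fst = p ∧ α a ξ < 0}
  have hs : s.card = index α ξ p := by
    rw [index, Nat.card_eq_fintype_card, Fintype.card_subtype]
  have hmem {a : G.Dart} (ha : a ∈ s) : a.fst = p ∧ α a ξ < 0 := by simpa [s] using ha
  rw [vertexDim, ← hs]
  refine finrank_le_of_symRestr_eq_zero s α (fun a _ => hα.ne_zero a)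
    (fun a ha b hb hab => hα.pairwise_independent a b ((hmem ha).1.trans (hmem hb).1.symm) hab)
    k _ ?_ ?_
  · rintro _ ⟨f, hf, rfl⟩
    exact (mem_supportedOn.mp hf).1.1 p
  · rintro _ ⟨f, hf, rfl⟩ a ha
    obtain ⟨rfl, hneg⟩ := hmem ha
    rw [SetLike.mem_coe, mem_supportedOn] at hf
    have hq : a.snd ∉ U := fun hU =>
      hp _ hU ⟨a.symm, rfl, rfl, by rw [hα.apply_symm]; exact neg_pos.mpr hneg⟩
    rw [LinearMap.proj_apply, hf.1.2 a, hf.2 _ hq, map_zero]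

theorem supportedOn_inf_ker_proj_le [DecidableEq V] (α : G.Dart → Dual ℝ g) (k : ℕ)
    (U : Finset V) (p : V) :
    supportedOn α k U ⊓ LinearMap.ker (LinearMap.proj p) ≤ supportedOn α k (U.erase p) := by
  rintro f ⟨hf, hfp⟩
  rw [SetLike.mem_coe, mem_supportedOn] at hf
  refine mem_supportedOn.mpr ⟨hf.1, fun q hq => ?_⟩
  by_cases hqp : q = p
  · rw [hqp]
    exact hfp
  · exact hf.2 q fun hU => hq (Finset.mem_erase.mpr ⟨hqp, hU⟩)

/-- A finite nonempty set of vertices has an element that no oriented edge from the set enters. -/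
theorem NoCycles.exists_minimal [Finite V] {α : G.Dart → Dual ℝ g} {ξ : g} (h : NoCycles α ξ)
    {U : Finset V} (hU : U.Nonempty) : ∃ p ∈ U, ∀ q ∈ U, ¬ OrientedEdge α ξ q p := by
  have : Std.Irrefl (Relation.TransGen (OrientedEdge α ξ)) := ⟨h⟩
  have hwf := Finite.wellFounded_of_trans_of_irrefl (Relation.TransGen (OrientedEdge α ξ))
  obtain ⟨p, hp, hmin⟩ := hwf.has_min (U : Set V) hU
  exact ⟨p, hp, fun q hq hqp => hmin q hq (Relation.TransGen.single hqp)⟩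

theorem IsAxial.finrank_supportedOn_le [Finite V] [FiniteDimensional ℝ g]
    {α : G.Dart → Dual ℝ g} (hα : IsAxial α) {ξ : g} (hcycle : NoCycles α ξ) (k : ℕ)
    (U : Finset V) : finrank ℝ (supportedOn α k U) ≤ ∑ p ∈ U, vertexDim α ξ k p := by
  classical
  induction U using Finset.strongInduction with
  | H U ih =>
    rcases U.eq_empty_or_nonempty with rfl | hU
    · have hbot : supportedOn α k ∅ = ⊥ := by
        refine (Submodule.eq_bot_iff _).mpr fun f hf => funext fun p => ?_
        exact (mem_supportedOn.mp hf).2 p (Finset.notMem_empty p)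
      rw [hbot, finrank_bot]
      exact Nat.zero_le _
    · obtain ⟨p, hp, hmin⟩ := hcycle.exists_minimal hU
      rw [← finrank_map_add_finrank_inf_ker (LinearMap.proj p) (supportedOn α k U),
        ← Finset.add_sum_erase U _ hp]
      exact add_le_add (hα.finrank_map_proj_supportedOn_le ξ k U p hmin)
        ((Submodule.finrank_mono (supportedOn_inf_ker_proj_le α k U p)).trans
          (ih _ (Finset.erase_ssubset hp)))

theorem IsAxial.finrank_cohomology_le [Finite V] [FiniteDimensional ℝ g]
    {α : G.Dart → Dual ℝ g} (hα : IsAxial α) {ξ : g} (hcycle : NoCycles α ξ) (k : ℕ) :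
    finrank ℝ (cohomology α k) ≤ bettiSum α ξ k := by
  have := Fintype.ofFinite V
  have h : supportedOn α k Finset.univ = cohomology α k := by
    ext f
    simp [mem_supportedOn]
  rw [← h, ← sum_vertexDim]
  exact hα.finrank_supportedOn_le hcycle k Finset.univ

end UpperBound

/-! ### Lower bound by counting equations -/

section LowerBound

variable {V : Type*} {G : SimpleGraph V} {g : Type*} [AddCommGroup g] [Module ℝ g]

/-- For `α a` and `α a.symm`, which are opposite, the two kernels are equal but are different types.
This lets one condition per edge suffice. -/
theorem symRestr_eq_of_ker_eq {β γ : Dual ℝ g} (h : LinearMap.ker β = LinearMap.ker γ)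
    {x y : SymmetricAlgebra ℝ (Dual ℝ g)} (hxy : symRestr β x = symRestr β y) :
    symRestr γ x = symRestr γ y := by
  have key (K L : Submodule ℝ g) (hKL : K = L)
      (hK : symMap K.subtype.dualMap x = symMap K.subtype.dualMap y) :
      symMap L.subtype.dualMap x = symMap L.subtype.dualMap y := by
    subst hKL
    exact hK
  exact key _ _ h hxy

/-- The difference of the restrictions of a map `f : V → S^k(𝔤*)` at the ends of the
edge `a`. -/
def edgeDifference (α : G.Dart → Dual ℝ g) (k : ℕ) (a : G.Dart) :
    (V → symPower (Dual ℝ g) k) →ₗ[ℝ] symPower (Dual ℝ (LinearMap.ker (α a))) k :=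
  ((symRestr (α a)).toLinearMap.restrict fun _ hx => symMap_mem_symPower (restr (α a)) hx) ∘ₗ
    ((LinearMap.proj a.fst : (V → symPower (Dual ℝ g) k) →ₗ[ℝ] _) - LinearMap.proj a.snd)

theorem edgeDifference_eq_zero_iff {α : G.Dart → Dual ℝ g} {k : ℕ} {a : G.Dart}
    {f : V → symPower (Dual ℝ g) k} :
    edgeDifference α k a f = 0 ↔ symRestr (α a) (f a.fst) = symRestr (α a) (f a.snd) := by
  rw [← Submodule.coe_eq_zero, ← sub_eq_zero (a := symRestr (α a) _), ← map_sub]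
  rfl

theorem IsAxial.mem_cohomology {α : G.Dart → Dual ℝ g} (hα : IsAxial α) {η : g}
    (hη : η ∈ generic α) {k : ℕ} {f : V → symPower (Dual ℝ g) k}
    (hf : ∀ a : {a : G.Dart // α a η < 0}, edgeDifference α k a.1 f = 0) :
    (fun p => (f p : SymmetricAlgebra ℝ (Dual ℝ g))) ∈ cohomology α k := by
  refine ⟨fun p => (f p).2, fun a => ?_⟩
  rcases lt_or_gt_of_ne (hη a) with h | h
  · exact edgeDifference_eq_zero_iff.mp (hf ⟨a, h⟩)
  · have hs := edgeDifference_eq_zero_iff.mp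
      (hf ⟨a.symm, by rw [hα.apply_symm]; exact neg_lt_zero.mpr h⟩)
    refine symRestr_eq_of_ker_eq ?_ hs.symm
    ext x
    rw [LinearMap.mem_ker, LinearMap.mem_ker, hα.apply_symm, neg_eq_zero]

/-- Rank-nullity for `Φ`, with one equation per edge: the darts negative at `η` choose one end of
each edge. -/
theorem IsAxial.card_mul_le_finrank_cohomology_add [Finite V] [FiniteDimensional ℝ g]
    {α : G.Dart → Dual ℝ g} (hα : IsAxial α) {η : g} (hη : η ∈ generic α) (k : ℕ) :
    Nat.card V * (finrank ℝ g).multichoose k ≤ finrank ℝ (cohomology α k) +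
      Nat.card {a : G.Dart // α a η < 0} * (finrank ℝ g - 1).multichoose k := by
  have : Finite G.Dart := finite_dart
  have := Fintype.ofFinite V
  have := Fintype.ofFinite {a : G.Dart // α a η < 0}
  let Φ : (V → symPower (Dual ℝ g) k) →ₗ[ℝ]
      ((a : {a : G.Dart // α a η < 0}) → symPower (Dual ℝ (LinearMap.ker (α a.1))) k) :=
    LinearMap.pi fun a => edgeDifference α k a.1
  have hdom : finrank ℝ (V → symPower (Dual ℝ g) k) =
      Nat.card V * (finrank ℝ g).multichoose k := by
    rw [Module.finrank_pi_fintype, Finset.sum_const, finrank_symPower_dual, smul_eq_mul,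
      Nat.card_eq_fintype_card, Finset.card_univ]
  have hcod : finrank ℝ ((a : {a : G.Dart // α a η < 0}) →
      symPower (Dual ℝ (LinearMap.ker (α a.1))) k) =
      Nat.card {a : G.Dart // α a η < 0} * (finrank ℝ g - 1).multichoose k := by
    have h (a : {a : G.Dart // α a η < 0}) :
        finrank ℝ (symPower (Dual ℝ (LinearMap.ker (α a.1))) k) =
          (finrank ℝ g - 1).multichoose k := by
      rw [finrank_symPower_dual, ← finrank_ker_add_one (hα.ne_zero a.1), Nat.add_sub_cancel]
    rw [Module.finrank_pi_fintype, Finset.sum_congr rfl fun a _ => h a, Finset.sum_const,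
      smul_eq_mul, Nat.card_eq_fintype_card, Finset.card_univ]
  let Ψ : LinearMap.ker Φ →ₗ[ℝ] cohomology α k :=
    LinearMap.codRestrict _
      ((LinearMap.pi fun p => (symPower (Dual ℝ g) k).subtype ∘ₗ LinearMap.proj p) ∘ₗ
        (LinearMap.ker Φ).subtype)
      fun f => hα.mem_cohomology hη fun a => congrFun f.2 a
  have hΨ : Function.Injective Ψ := fun f h hfh =>
    Subtype.ext (funext fun p => Subtype.ext (congrFun (congrArg Subtype.val hfh) p))
  rw [← hdom, ← hcod, ← LinearMap.finrank_range_add_finrank_ker Φ, add_comm]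
  exact add_le_add (LinearMap.finrank_le_finrank_of_injective hΨ) (Submodule.finrank_le _)

theorem card_negative_darts [Fintype V] (α : G.Dart → Dual ℝ g) (η : g) :
    Nat.card {a : G.Dart // α a η < 0} = ∑ p, index α η p := by
  have : Finite G.Dart := finite_dart
  simp only [index]
  rw [← Nat.card_sigma]
  refine Nat.card_congr ((Equiv.sigmaFiberEquiv fun a : {a : G.Dart // α a η < 0} =>
    a.1.fst).symm.trans (Equiv.sigmaCongrRight fun p => ?_))
  exact (Equiv.subtypeSubtypeEquivSubtypeInter (fun a : G.Dart => α a η < 0)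
    fun a => a.fst = p).trans (Equiv.subtypeEquivRight fun a => and_comm)

end LowerBound

/-! ### Estimates for dimensions of symmetric powers -/

section Multichoose

theorem multichoose_mono_of_pos (m : ℕ) {k : ℕ} (hk : 0 < k) :
    m.multichoose k ≤ m.multichoose (k + 1) := by
  cases m with
  | zero =>
    obtain ⟨k, rfl⟩ := Nat.exists_eq_succ_of_ne_zero hk.ne'
    rw [Nat.succ_eq_add_one, Nat.multichoose_zero_succ]
    exact Nat.zero_le _
  | succ m =>
    rw [Nat.multichoose_succ_succ]
    exact Nat.le_add_left _ _

/-- A second-order Taylor estimate: `r` backward differences, each compared with the difference at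
the endpoint, at a cost of at most `r ^ 2` second differences. Positivity of `k` matters because
`Nat.multichoose 0` drops from 1 to 0 at the start. -/
theorem multichoose_add_le (m : ℕ) {k : ℕ} (hk : 0 < k) (r : ℕ) :
    (m + 2).multichoose k + r * (m + 1).multichoose (k + r) ≤
      (m + 2).multichoose (k + r) + r ^ 2 * m.multichoose (k + r) := by
  induction r with
  | zero => simp
  | succ r ih =>
    have h1 := multichoose_mono_of_pos m (show 0 < k + r by omega)
    rw [← add_assoc, Nat.multichoose_succ_succ (m + 1), Nat.multichoose_succ_succ m]
    have h2 := Nat.mul_le_mul_left (r ^ 2) h1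
    nlinarith

theorem multichoose_sub_add_le (n : ℕ) {k r : ℕ} (hk : r < k) :
    n.multichoose (k - r) + r * (n - 1).multichoose k ≤
      n.multichoose k + r ^ 2 * (n - 2).multichoose k := by
  obtain ⟨j, rfl⟩ : ∃ j, k = j + 1 + r := ⟨k - r - 1, by omega⟩
  rw [Nat.add_sub_cancel]
  match n with
  | 0 => simp [Nat.multichoose_zero_succ, Nat.add_right_comm j 1 r]
  | 1 => simp [Nat.multichoose_zero_succ, Nat.add_right_comm j 1 r]
  | m + 2 => exact multichoose_add_le m (Nat.succ_pos j) r

theorem multichoose_succ_le_pow (m k : ℕ) : (m + 1).multichoose k ≤ (k + 1) ^ m := by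
  induction m generalizing k with
  | zero => simp
  | succ m ih =>
    induction k with
    | zero => simp
    | succ k ihk =>
      rw [Nat.multichoose_succ_succ]
      calc (m + 1).multichoose (k + 1) + (m + 1 + 1).multichoose k
          ≤ (k + 1 + 1) ^ m + (k + 1) ^ (m + 1) := add_le_add (ih (k + 1)) ihk
        _ ≤ (k + 1 + 1) ^ m + (k + 1 + 1) ^ m * (k + 1) := by
            rw [pow_succ (k + 1)]
            gcongr
            omega
        _ = (k + 1 + 1) ^ (m + 1) := by ring

theorem multichoose_sub_two_le (n : ℕ) {k : ℕ} (hk : 0 < k) :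
    ((n - 2).multichoose k : ℝ) ≤ 2 ^ (n - 3) * (k : ℝ) ^ ((n : ℤ) - 3) := by
  have hk1 : (1 : ℝ) ≤ k := by exact_mod_cast hk
  rcases lt_or_ge n 3 with hn | hn
  · rw [show n - 2 = 0 by omega]
    obtain ⟨j, rfl⟩ := Nat.exists_eq_succ_of_ne_zero hk.ne'
    rw [Nat.succ_eq_add_one, Nat.multichoose_zero_succ, Nat.cast_zero]
    exact mul_nonneg (by positivity) (zpow_nonneg (Nat.cast_nonneg _) _)
  · obtain ⟨m, rfl⟩ := Nat.exists_eq_add_of_le' hn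
    rw [show m + 3 - 2 = m + 1 by omega, show m + 3 - 3 = m by omega,
      show ((m + 3 : ℕ) : ℤ) - 3 = (m : ℤ) by push_cast; ring, zpow_natCast, ← mul_pow]
    calc ((m + 1).multichoose k : ℝ) ≤ ((k + 1 : ℕ) : ℝ) ^ m := by
          exact_mod_cast multichoose_succ_le_pow m k
      _ ≤ (2 * k) ^ m := by
          gcongr
          push_cast
          linarith

end Multichoose

/-! ### Comparison of the Betti sum with the lower bound -/

section Asymptotics

variable {V : Type*} {G : SimpleGraph V} {g : Type*} [AddCommGroup g] [Module ℝ g]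

theorem IsAxial.exists_bettiSum_le [Finite V] [FiniteDimensional ℝ g]
    {α : G.Dart → Dual ℝ g} (hα : IsAxial α) {η : g} (hη : η ∈ generic α) :
    ∃ k₀ C : ℕ, ∀ k, k₀ < k →
      bettiSum α η k ≤ finrank ℝ (cohomology α k) + C * (finrank ℝ g - 2).multichoose k := by
  have := Fintype.ofFinite V
  -- The threshold makes every index smaller than `k`; `C` collects the errors `r ^ 2` of the
  -- vertices. The terms in `multichoose (n - 1)` cancel because the sum of the indices is the
  -- number of edges.
  refine ⟨∑ p, index α η p, ∑ p, index α η p ^ 2, fun k hk => ?_⟩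
  have hlt (p : V) : index α η p < k :=
    (Finset.single_le_sum (f := index α η) (fun _ _ => Nat.zero_le _) (Finset.mem_univ p)).trans_lt
      hk
  have h1 := hα.card_mul_le_finrank_cohomology_add hη k
  have h2 := Finset.sum_le_sum fun p (_ : p ∈ Finset.univ) =>
    multichoose_sub_add_le (finrank ℝ g) (hlt p)
  have h3 : bettiSum α η k = ∑ p, (finrank ℝ g).multichoose (k - index α η p) := by
    rw [← sum_vertexDim]
    exact Finset.sum_congr rfl fun p _ => by
      rw [vertexDim, if_pos (hlt p).le, finrank_symPower_dual]
  rw [Finset.sum_add_distrib, Finset.sum_add_distrib, ← Finset.sum_mul, ← Finset.sum_mul, ← h3,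
    Finset.sum_const, Finset.card_univ, smul_eq_mul] at h2
  rw [card_negative_darts, Nat.card_eq_fintype_card] at h1
  omega

end Asymptotics

end GraphCohomology

end

open GraphCohomology in
theorem mainTheorem6 {V : Type*} [Finite V] (G : SimpleGraph V) [G.LocallyFinite]
    (d : ℕ) (hd : G.IsRegularOfDegree d)
    {g : Type*} [AddCommGroup g] [Module ℝ g] [FiniteDimensional ℝ g]
    (α : G.Dart → Module.Dual ℝ g) (hα : GraphCohomology.IsAxial α)
    (ξ : g) (hξ : ξ ∈ GraphCohomology.generic α) (hcycle : GraphCohomology.NoCycles α ξ)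
    (η : g) (hη : η ∈ GraphCohomology.generic α) :
    (∀ k : ℕ, Module.finrank ℝ (GraphCohomology.cohomology α k) ≤
        GraphCohomology.bettiSum α η k) ∧
    ((fun k : ℕ => (Module.finrank ℝ (GraphCohomology.cohomology α k) : ℝ) -
        (GraphCohomology.bettiSum α η k : ℝ)) =O[Filter.atTop]
      fun k : ℕ => (k : ℝ) ^ ((Module.finrank ℝ g : ℤ) - 3)) ∧
    (Module.finrank ℝ g = 2 → ∃ k₀ : ℕ, ∀ k : ℕ, k₀ < k →
      Module.finrank ℝ (GraphCohomology.cohomology α k) =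
        GraphCohomology.bettiSum α η k) := by
  have upper (k : ℕ) : finrank ℝ (cohomology α k) ≤ bettiSum α η k :=
    (hα.finrank_cohomology_le hcycle k).trans_eq (bettiSum_congr (hα.betti_eq hξ hη) k)
  obtain ⟨k₀, C, lower⟩ := hα.exists_bettiSum_le hη
  refine ⟨upper, ?_, fun hn => ⟨k₀, fun k hk => le_antisymm (upper k) ?_⟩⟩
  · refine Asymptotics.IsBigO.of_bound (C * 2 ^ (finrank ℝ g - 3)) ?_
    filter_upwards [Filter.eventually_gt_atTop k₀] with k hk
    have h1 : (finrank ℝ (cohomology α k) : ℝ) ≤ bettiSum α η k := by exact_mod_cast upper k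
    have h2 : (bettiSum α η k : ℝ) ≤
        finrank ℝ (cohomology α k) + C * (finrank ℝ g - 2).multichoose k := by
      exact_mod_cast lower k hk
    have h3 := mul_le_mul_of_nonneg_left
      (multichoose_sub_two_le (finrank ℝ g) (Nat.zero_lt_of_lt hk)) (Nat.cast_nonneg (α := ℝ) C)
    have h4 : (0 : ℝ) ≤ (k : ℝ) ^ ((finrank ℝ g : ℤ) - 3) := by positivity
    rw [Real.norm_of_nonpos (by linarith), Real.norm_of_nonneg h4]
    linarith
  -- Here the error is a multiple of `Nat.multichoose 0 k`, which vanishes for `k > 0`.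
  · obtain ⟨j, rfl⟩ := Nat.exists_eq_succ_of_ne_zero (Nat.zero_lt_of_lt hk).ne'
    have h := lower _ hk
    rwa [hn, Nat.sub_self, Nat.succ_eq_add_one, Nat.multichoose_zero_succ, mul_zero,
      add_zero] at h
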